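/- Let $n\ge 2$ agents have additive costs over $m$ indivisible chores: $c_{ij}\ge 0$, $c_i(S)=\sum_{j\in S}c_{ij}$, and $c_i(\mathcal M)>0$ for every agent $i$, where $\mathcal M$ is the set of all chores. Let $p\ge 1$ be real. A fractional allocation is a matrix $x=(x_{ij})$ with $x_{ij}\ge 0$ and $\sum_i x_{ij}=1$ for every chore $j$; put $c_i(x_i)=\sum_j x_{ij}c_{ij}$. An integral allocation $\mathbf a=(\mathbf a_1,\dots,\mathbf a_n)$ is a partition of $\mathcal M$, identified with its $0/1$ matrix. The normalized $p$-mean of $x$ is $\bigl(\frac1n\sum_{i}(c_i(x_i)/c_i(\mathcal M))^p\bigr)^{1/p}$. A triple $(x,\mathbf r,\mathbf e)$ is a market equilibrium if $x$ is a fractional allocation, the rewards satisfy $r_j\ge 0$, the earnings satisfy $\sum_j x_{ij}r_j=e_i$, and each agent performs only chores of maximum reward-to-cost ratio: for every $i$ there is $\mathrm{MRC}_i\in(0,\infty)$ such that $r_j\le \mathrm{MRC}_i\,c_{ij}$ for all $j$, with equality whenever $x_{ij}>0$. A rounding of a market equilibrium $(x,\mathbf r,\mathbf e)$ is a market equilibrium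 $(\mathbf a,\mathbf r,\mathbf e')$ with $\mathbf a$ integral such that, whenever $e'_i>e_i$, there is a chore $j\in\mathbf a_i$ with $e'_i-r_j\le e_i$ (this is the guarantee of the Brânzei–Sandomirskiy rounding procedure). Consider the following algorithm: (1) let $x$ be a fractional allocation that minimizes the normalized $p$-mean, and let $(x,\mathbf r,\mathbf e)$ be a market equilibrium; (2) return the integral allocation $\mathbf a$ of a rounding $(\mathbf a,\mathbf r,\mathbf e')$ of $(x,\mathbf r,\mathbf e)$. Theorem. The algorithm can always be carried out: a minimizer $x$ exists; for every minimizer $x$ there are $\mathbf r,\mathbf e$ such that $(x,\mathbf r,\mathbf e)$ is a market equilibrium; and every market equilibrium has a rounding. Moreover, whatever choices are made, the output $\mathbf a$ is - fPO: there is no fractional allocation $y$ with $c_i(y_i)\le c_i(\mathbf a_i)$ for all $i$ and $c_i(y_i)<c_i(\mathbf a_i)$ for some $i$; and - $n^{1/p}$-PROP1: for every $i$ with $\mathbf a_i\neq\emptyset$ there is $j\in\mathbf a_i$ with $c_i(\mathbf a_i\setminus\{j\})\le n^{1/p}\,\dfrac{c_i(\mathcal M)}{n}$. -/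

import Mathlib

open scoped BigOperators

namespace ChoreDivision

noncomputable section

/-- A fractional allocation of `m` chores to `n` agents: `x i j` is the fraction of chore `j`
given to agent `i`, and every chore is completely allocated. -/
def IsFracAllocation {n m : ℕ} (x : Fin n → Fin m → ℝ) : Prop :=
  (∀ i j, 0 ≤ x i j) ∧ ∀ j, ∑ i, x i j = 1

/-- The cost `c_i(M)` that agent `i` has for the set of all chores. -/
def totalCost {n m : ℕ} (c : Fin n → Fin m → ℝ) (i : Fin n) : ℝ :=
  ∑ j, c i j

/-- The cost `c_i(x_i)` that agent `i` has for her own bundle in a fractional allocation. -/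
def fracCost {n m : ℕ} (c x : Fin n → Fin m → ℝ) (i : Fin n) : ℝ :=
  ∑ j, x i j * c i j

/-- The cost `c_i(S)` that agent `i` has for a set `S` of indivisible chores. -/
def setCost {n m : ℕ} (c : Fin n → Fin m → ℝ) (i : Fin n) (S : Finset (Fin m)) : ℝ :=
  ∑ j ∈ S, c i j

/-- The `p`-mean of a vector of nonnegative reals. -/
def pMean {n : ℕ} (p : ℝ) (u : Fin n → ℝ) : ℝ :=
  ((∑ i, u i ^ p) / n) ^ (1 / p)

/-- The `p`-mean of the normalized disutilities `c_i(x_i) / c_i(M)`. -/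
def normalizedPMean {n m : ℕ} (c : Fin n → Fin m → ℝ) (p : ℝ) (x : Fin n → Fin m → ℝ) : ℝ :=
  pMean p fun i => fracCost c x i / totalCost c i

/-- `x` minimizes the normalized `p`-mean of disutilities among all fractional allocations. -/
def IsNormalizedPMeanMinimizer {n m : ℕ} (c : Fin n → Fin m → ℝ) (p : ℝ)
    (x : Fin n → Fin m → ℝ) : Prop :=
  IsFracAllocation x ∧
    ∀ y : Fin n → Fin m → ℝ, IsFracAllocation y → normalizedPMean c p x ≤ normalizedPMean c p y

/-- `(x, r, e)` is a market equilibrium for divisible chores, with rewards `r j` for the chores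
and earnings `e i` of the agents: all chores are completely allocated, agent `i` earns exactly
`e i`, and agent `i` only performs chores whose reward-to-cost ratio is maximum for her.
The last condition is written without division: `mrc i` is a positive (finite) bound for all
ratios `r j / c i j`, attained at every chore of which agent `i` performs a positive fraction.
So a chore that costs nothing to some agent has reward zero, and a chore with reward zero is
performed only by agents to whom it costs nothing. -/
def IsMarketEquilibrium {n m : ℕ} (c x : Fin n → Fin m → ℝ) (r : Fin m → ℝ)
    (e : Fin n → ℝ) : Prop :=
  IsFracAllocation x ∧ (∀ j, 0 ≤ r j) ∧ (∀ i, ∑ j, x i j * r j = e i) ∧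
    ∃ mrc : Fin n → ℝ, ∀ i, 0 < mrc i ∧
      (∀ j, r j ≤ mrc i * c i j) ∧ ∀ j, 0 < x i j → r j = mrc i * c i j

/-- An integral allocation is a map `a` sending every chore to the agent who performs it;
this is the set of chores given to agent `i`. -/
def bundle {n m : ℕ} (a : Fin m → Fin n) (i : Fin n) : Finset (Fin m) :=
  Finset.univ.filter fun j => a j = i

/-- An integral allocation, seen as a fractional allocation with entries 0 and 1. -/
def toFrac {n m : ℕ} (a : Fin m → Fin n) : Fin n → Fin m → ℝ :=
  fun i j => if a j = i then 1 else 0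

/-- Fractional Pareto optimality: no fractional allocation is at most as costly for every agent
and strictly less costly for some agent. -/
def IsFPO {n m : ℕ} (c x : Fin n → Fin m → ℝ) : Prop :=
  ¬ ∃ y : Fin n → Fin m → ℝ, IsFracAllocation y ∧
    (∀ i, fracCost c y i ≤ fracCost c x i) ∧ ∃ i, fracCost c y i < fracCost c x i

/-- `α`-PROP1 for chores: every agent who gets some chore can drop one of her chores so that the
cost of the others is at most `α` times her proportional share `c_i(M) / n`. -/
def IsPROP1 {n m : ℕ} (c : Fin n → Fin m → ℝ) (α : ℝ) (a : Fin m → Fin n) : Prop :=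
  ∀ i, (bundle a i).Nonempty →
    ∃ j ∈ bundle a i, setCost c i ((bundle a i).erase j) ≤ α * (totalCost c i / n)

/-- `(a, r, e')` is a rounding of the market equilibrium with rewards `r` and earnings `e`:
`a` is an integral allocation, `(a, r, e')` is a market equilibrium with the same rewards, and
every agent whose earnings went up has a chore without which she would earn at most `e i`. -/
def IsEquilibriumRounding {n m : ℕ} (c : Fin n → Fin m → ℝ) (r : Fin m → ℝ) (e : Fin n → ℝ)
    (a : Fin m → Fin n) (e' : Fin n → ℝ) : Prop :=
  IsMarketEquilibrium c (toFrac a) r e' ∧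
    ∀ i, e i < e' i → ∃ j ∈ bundle a i, e' i - r j ≤ e i

/-- `a` is a possible output of the algorithm: take a fractional allocation `x` minimizing the
normalized `p`-mean of disutilities, take a market equilibrium `(x, r, e)`, round it to an
integral market equilibrium `(a, r, e')`, and return `a`. -/
def IsAlgorithmOutput {n m : ℕ} (c : Fin n → Fin m → ℝ) (p : ℝ) (a : Fin m → Fin n) : Prop :=
  ∃ (x : Fin n → Fin m → ℝ) (r : Fin m → ℝ) (e e' : Fin n → ℝ),
    IsNormalizedPMeanMinimizer c p x ∧ IsMarketEquilibrium c x r e ∧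
      IsEquilibriumRounding c r e a e'

end

end ChoreDivision

namespace ChoreDivision

open Finset

/-! A minimizer costs no agent more than `n ^ (1 / p)` proportional shares: the equal split bounds
the sum of `p`-th powers, hence each term (`IsNormalizedPMeanMinimizer.fracCost_le`). Rounding
preserves this up to one chore, because rewards are costs scaled by the agent's ratio
(`IsEquilibriumRounding.exists_setCost_erase_le`), and fPO is the first welfare theorem.

Rewards come from the first-order conditions: with `w i` proportional to the derivative of the
objective in agent `i`'s cost, each chore goes only to agents minimizing `w i * c i j`, and this
minimum is its reward.

A rounding exists because an allocation of minimal support with the same earnings has few positive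
entries, by a dimension count. Hall's theorem then matches the shared chores to distinct performers,
so each agent receives at most one chore not already entirely hers. -/

/-! ### Rounding a fractional allocation by support reduction and Hall's theorem -/

/-- Moving from a nonnegative vector along a direction supported on its support, one coordinate
can be made zero while all stay nonnegative. -/
theorem exists_add_mul_nonneg_eq_zero {ι : Type*} [Fintype ι] {x z : ι → ℝ}
    (hx : ∀ k, 0 ≤ x k) (hsupp : ∀ k, x k = 0 → z k = 0) (hz : ∃ k, z k ≠ 0) :
    ∃ t : ℝ, (∀ k, 0 ≤ x k + t * z k) ∧ ∃ k, x k ≠ 0 ∧ x k + t * z k = 0 := by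
  classical
  obtain ⟨k₀, hk₀⟩ := hz
  -- With absolute values in the ratio, the step moves no coordinate by more than its size, so the
  -- signs of `z` do not matter.
  obtain ⟨k, hk, hmin⟩ := (univ.filter fun k => z k ≠ 0).exists_min_image
    (fun k => x k / |z k|) ⟨k₀, by simpa using hk₀⟩
  have hk : z k ≠ 0 := by simpa using hk
  refine ⟨-(x k / z k), fun l => ?_, k, fun h => hk (hsupp k h), by field_simp; ring⟩
  by_cases hl : z l = 0
  · simpa [hl] using hx l
  have h := hmin l (by simpa using hl)
  have hpos : 0 < |z l| := abs_pos.2 hl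
  rw [le_div_iff₀ hpos] at h
  have habs : |x k / z k * z l| = x k / |z k| * |z l| := by
    rw [abs_mul, abs_div, abs_of_nonneg (hx k)]
  have := le_abs_self (x k / z k * z l)
  linarith

variable {n m : ℕ}

/-- The agents who perform a positive fraction of chore `j`. -/
noncomputable def performers (y : Fin n → Fin m → ℝ) (j : Fin m) : Finset (Fin n) :=
  univ.filter fun i => y i j ≠ 0

/-- If there are more positive entries in the columns `S` than `S` and its performers together,
then the shares of these chores can be changed without changing the earnings. -/
theorem exists_earnings_preserving_direction (y : Fin n → Fin m → ℝ) (r : Fin m → ℝ)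
    (S : Finset (Fin m))
    (hcard : #S + #(S.biUnion (performers y)) < ∑ j ∈ S, #(performers y j)) :
    ∃ z : Fin n → Fin m → ℝ, (∀ i j, y i j = 0 → z i j = 0) ∧ (∀ j, ∑ i, z i j = 0) ∧
      (∀ i, ∑ j, z i j * r j = 0) ∧ ∃ i j, z i j ≠ 0 := by
  classical
  set N := S.biUnion (performers y)
  set E : Finset (Σ _ : Fin m, Fin n) := S.sigma (performers y) with hE
  -- One unknown per positive entry in `S`, one equation per chore of `S` and one per performer:
  -- `hcard` forces a nonzero kernel.
  let L : (E → ℝ) →ₗ[ℝ] (S → ℝ) × (N → ℝ) :=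
    { toFun := fun w => (fun j => ∑ e : E, if e.1.1 = j.1 then w e else 0,
        fun i => ∑ e : E, if e.1.2 = i.1 then w e * r e.1.1 else 0)
      map_add' := fun v w => by
        ext k
        · simp only [Pi.add_apply, Prod.fst_add, ← sum_add_distrib]
          exact sum_congr rfl fun e _ => by split_ifs <;> simp
        · simp only [Pi.add_apply, Prod.snd_add, ← sum_add_distrib]
          exact sum_congr rfl fun e _ => by split_ifs <;> simp [add_mul]
      map_smul' := fun t w => by
        ext k
        · simp [mul_sum]
        · simp [mul_sum, mul_assoc] }
  have hlt : Module.finrank ℝ ((S → ℝ) × (N → ℝ)) < Module.finrank ℝ (E → ℝ) := by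
    rw [Module.finrank_prod, Module.finrank_fintype_fun_eq_card, Module.finrank_fintype_fun_eq_card,
      Module.finrank_fintype_fun_eq_card, Fintype.card_coe, Fintype.card_coe, Fintype.card_coe, hE,
      card_sigma]
    exact hcard
  obtain ⟨w, hw, hw0⟩ := (Submodule.ne_bot_iff _).1 (LinearMap.ker_ne_bot_of_finrank_lt (f := L) hlt)
  have hL : L w = 0 := hw
  have h1 : ∀ j ∈ S, (∑ e : E, if e.1.1 = j then w e else 0) = 0 := fun j hj =>
    congrFun (congrArg Prod.fst hL) ⟨j, hj⟩
  have h2 : ∀ i ∈ N, (∑ e : E, if e.1.2 = i then w e * r e.1.1 else 0) = 0 := fun i hi =>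
    congrFun (congrArg Prod.snd hL) ⟨i, hi⟩
  have hmem : ∀ e : E, e.1.1 ∈ S ∧ e.1.2 ∈ performers y e.1.1 := fun e => mem_sigma.1 e.2
  refine ⟨fun i j => ∑ e : E, if e.1.1 = j ∧ e.1.2 = i then w e else 0, fun i j hij => ?_,
    fun j => ?_, fun i => ?_, ?_⟩
  · refine sum_eq_zero fun e _ => if_neg ?_
    rintro ⟨rfl, rfl⟩
    exact (mem_filter.1 (hmem e).2).2 hij
  · rw [sum_comm]
    have : ∀ e : E, (∑ i, if e.1.1 = j ∧ e.1.2 = i then w e else 0) =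
        if e.1.1 = j then w e else 0 := fun e => by
      by_cases h : e.1.1 = j <;> simp [h]
    simp only [this]
    by_cases hj : j ∈ S
    · exact h1 j hj
    · refine sum_eq_zero fun e _ => if_neg ?_
      rintro rfl
      exact hj (hmem e).1
  · simp only [sum_mul]
    rw [sum_comm]
    have : ∀ e : E, (∑ j, (if e.1.1 = j ∧ e.1.2 = i then w e else 0) * r j) =
        if e.1.2 = i then w e * r e.1.1 else 0 := fun e => by
      by_cases h : e.1.2 = i <;> simp [h]
    simp only [this]
    by_cases hi : i ∈ N
    · exact h2 i hi
    · refine sum_eq_zero fun e _ => if_neg ?_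
      rintro rfl
      exact hi (mem_biUnion.2 ⟨_, (hmem e).1, (hmem e).2⟩)
  · obtain ⟨e₀, he₀⟩ := Function.ne_iff.1 hw0
    refine ⟨e₀.1.2, e₀.1.1, ?_⟩
    beta_reduce
    rw [sum_eq_single e₀]
    · simpa using he₀
    · rintro e - hne
      refine if_neg fun h => hne (Subtype.ext ?_)
      exact Sigma.ext h.1 (heq_of_eq h.2)
    · simp

/-- Among the fractional allocations with given earnings and support in that of `x`, there is one
whose support contains no earnings-preserving direction. -/
theorem exists_rigid_allocation {x : Fin n → Fin m → ℝ} (hx : IsFracAllocation x)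
    (r : Fin m → ℝ) :
    ∃ y : Fin n → Fin m → ℝ, IsFracAllocation y ∧
      (∀ i, ∑ j, y i j * r j = ∑ j, x i j * r j) ∧ (∀ i j, x i j = 0 → y i j = 0) ∧
      ∀ z : Fin n → Fin m → ℝ, (∀ i j, y i j = 0 → z i j = 0) → (∀ j, ∑ i, z i j = 0) →
        (∀ i, ∑ j, z i j * r j = 0) → ∀ i j, z i j = 0 := by
  classical
  let P : Set (Fin n → Fin m → ℝ) := {y | IsFracAllocation y ∧
      (∀ i, ∑ j, y i j * r j = ∑ j, x i j * r j) ∧ ∀ i j, x i j = 0 → y i j = 0}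
  let supp : (Fin n → Fin m → ℝ) → Finset (Fin n × Fin m) :=
    fun y => univ.filter fun k => y k.1 k.2 ≠ 0
  -- For `y` of minimal support, a nonzero direction would allow a move that kills one more entry.
  obtain ⟨y, ⟨hy, hye, hyx⟩, hmin⟩ := (measure fun y => #(supp y)).wf.has_min P
    ⟨x, hx, fun _ => rfl, fun _ _ h => h⟩
  refine ⟨y, hy, hye, hyx, fun z hzy hzj hzi => ?_⟩
  by_contra! hne
  obtain ⟨i₀, j₀, h₀⟩ := hne
  obtain ⟨t, ht, ⟨i₁, j₁⟩, h₁, h₂⟩ := exists_add_mul_nonneg_eq_zero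
    (x := fun k : Fin n × Fin m => y k.1 k.2) (z := fun k => z k.1 k.2)
    (fun k => hy.1 _ _) (fun k => hzy _ _) ⟨(i₀, j₀), h₀⟩
  refine hmin (fun i j => y i j + t * z i j) ⟨⟨fun i j => ht (i, j), fun j => ?_⟩, fun i => ?_,
    fun i j h => ?_⟩ ?_
  · rw [sum_add_distrib, ← mul_sum, hzj, hy.2]; ring
  · simp only [add_mul, mul_assoc]
    rw [sum_add_distrib, ← mul_sum, hzi, hye]; ring
  · simp [hyx i j h, hzy i j (hyx i j h)]
  · refine card_lt_card ((ssubset_iff_of_subset fun k hk => ?_).2 ⟨(i₁, j₁), ?_, ?_⟩)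
    · refine mem_filter.2 ⟨mem_univ _, fun h => (mem_filter.1 hk).2 ?_⟩
      simp [h, hzy _ _ h]
    · exact mem_filter.2 ⟨mem_univ _, h₁⟩
    · exact fun h => (mem_filter.1 h).2 h₂

theorem IsFracAllocation.le_one {x : Fin n → Fin m → ℝ} (hx : IsFracAllocation x) (i : Fin n)
    (j : Fin m) : x i j ≤ 1 :=
  hx.2 j ▸ single_le_sum (f := fun i => x i j) (fun i _ => hx.1 i j) (mem_univ i)

/-- A chore that nobody performs completely has at least two performers. -/
theorem two_le_card_performers {y : Fin n → Fin m → ℝ} (hy : IsFracAllocation y) {j : Fin m}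
    (hj : ∀ i, y i j ≠ 1) : 2 ≤ #(performers y j) := by
  classical
  have hsum : ∑ i ∈ performers y j, y i j = 1 := by
    rw [performers, sum_filter_ne_zero, hy.2]
  by_contra! hlt
  interval_cases h : #(performers y j)
  · simp [card_eq_zero.1 h] at hsum
  · obtain ⟨i, hi⟩ := card_eq_one.1 h
    rw [hi, sum_singleton] at hsum
    exact hj i hsum

/-- Every fractional allocation can be rounded within its support such that the earnings exceed
the original ones by at most the reward of one of the chores received. -/
theorem exists_rounding {x : Fin n → Fin m → ℝ} (hx : IsFracAllocation x) {r : Fin m → ℝ}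
    (hr : ∀ j, 0 ≤ r j) :
    ∃ a : Fin m → Fin n, (∀ j, x (a j) j ≠ 0) ∧
      ∀ i, ∑ j ∈ bundle a i, r j ≤ ∑ j, x i j * r j ∨
        ∃ j ∈ bundle a i, ∑ j ∈ bundle a i, r j - r j ≤ ∑ j, x i j * r j := by
  classical
  obtain ⟨y, hy, hye, hyx, hrigid⟩ := exists_rigid_allocation hx r
  let F := {j : Fin m // ∀ i, y i j ≠ 1}
  -- Hall's condition: the columns `s` contain at least `2 * #s` positive entries, and by rigidity
  -- at most `#s` plus the number of their performers.
  obtain ⟨f, hfinj, hf⟩ := (all_card_le_biUnion_card_iff_exists_injective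
    (fun j : F => performers y j.1)).1 fun s => by
      have hle : ∑ j ∈ s.map (.subtype _), #(performers y j) ≤
          #(s.map (.subtype _)) + #((s.map (.subtype _)).biUnion (performers y)) := by
        by_contra! hlt
        obtain ⟨z, h1, h2, h3, i, j, hij⟩ := exists_earnings_preserving_direction y r _ hlt
        exact hij (hrigid z h1 h2 h3 i j)
      have h2 : 2 * #s ≤ ∑ j ∈ s, #(performers y j.1) := by
        rw [mul_comm, ← smul_eq_mul]
        exact card_nsmul_le_sum _ _ _ fun j _ => two_le_card_performers hy j.2
      have hunion : (s.map (.subtype _)).biUnion (performers y) =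
          s.biUnion fun j => performers y j.1 := by
        rw [map_eq_image, image_biUnion]
        rfl
      rw [sum_map, card_map, hunion] at hle
      have := h2.trans hle
      omega
  have hchoice : ∀ j, ∃ i, y i j ≠ 0 ∧ (y i j = 1 ∨ ∃ h : ∀ i, y i j ≠ 1, f ⟨j, h⟩ = i) := by
    intro j
    by_cases h : ∀ i, y i j ≠ 1
    · exact ⟨f ⟨j, h⟩, (mem_filter.1 (hf ⟨j, h⟩)).2, .inr ⟨h, rfl⟩⟩
    · push Not at h
      obtain ⟨i, hi⟩ := h
      exact ⟨i, by simp [hi], .inl hi⟩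
  choose a ha0 ha using hchoice
  refine ⟨a, fun j h => ha0 j (hyx _ _ h), fun i => ?_⟩
  have hbundle : ∀ T ⊆ bundle a i, (∀ j ∈ T, y i j = 1) →
      ∑ j ∈ T, r j ≤ ∑ j, x i j * r j := fun T _ hT => by
    rw [← hye]
    calc ∑ j ∈ T, r j = ∑ j ∈ T, y i j * r j := sum_congr rfl fun j hj => by rw [hT j hj, one_mul]
      _ ≤ ∑ j, y i j * r j := sum_le_univ_sum_of_nonneg fun j => mul_nonneg (hy.1 i j) (hr j)
  by_cases hfull : ∀ j ∈ bundle a i, y i j = 1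
  · exact .inl (hbundle _ subset_rfl hfull)
  · push Not at hfull
    obtain ⟨j, hj, hji⟩ := hfull
    refine .inr ⟨j, hj, ?_⟩
    rw [← sum_erase_eq_sub hj]
    refine hbundle _ (erase_subset _ _) fun k hk => ?_
    obtain ⟨hkj, hk⟩ := mem_erase.1 hk
    have haj : a j = i := (mem_filter.1 hj).2
    have hak : a k = i := (mem_filter.1 hk).2
    -- If `k` were also assigned by the matching, injectivity of `f` would give `k = j`.
    rcases ha k with h | ⟨hk', h⟩
    · rwa [hak] at h
    rcases ha j with h' | ⟨hj', h'⟩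
    · exact absurd (haj ▸ h') hji
    · exact absurd (congrArg Subtype.val (hfinj (h.trans (hak.trans (haj.symm.trans h'.symm))))) hkj

/-! ### Market equilibria: rounding, fPO and the cost after dropping a chore -/

theorem isFracAllocation_toFrac (a : Fin m → Fin n) : IsFracAllocation (toFrac a) :=
  ⟨fun i j => by unfold toFrac; split_ifs <;> norm_num, fun j => by simp [toFrac]⟩

theorem sum_toFrac_mul (a : Fin m → Fin n) (i : Fin n) (f : Fin m → ℝ) :
    ∑ j, toFrac a i j * f j = ∑ j ∈ bundle a i, f j := by
  simp [toFrac, bundle, sum_filter]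

/-- The rounding stays inside the support of `x`, so the same ratios `mrc` still certify the
equilibrium. -/
theorem IsMarketEquilibrium.exists_rounding {c x : Fin n → Fin m → ℝ} {r : Fin m → ℝ}
    {e : Fin n → ℝ} (h : IsMarketEquilibrium c x r e) :
    ∃ (a : Fin m → Fin n) (e' : Fin n → ℝ), IsEquilibriumRounding c r e a e' := by
  obtain ⟨hx, hr, he, mrc, hmrc⟩ := h
  obtain ⟨a, ha, hround⟩ := ChoreDivision.exists_rounding hx hr
  refine ⟨a, fun i => ∑ j ∈ bundle a i, r j, ⟨isFracAllocation_toFrac a, hr,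
    fun i => sum_toFrac_mul a i r, mrc, fun i => ⟨(hmrc i).1, (hmrc i).2.1, fun j hj => ?_⟩⟩,
    fun i hi => ?_⟩
  · have haj : a j = i := by
      by_contra hne
      simp [toFrac, hne] at hj
    exact (hmrc i).2.2 j ((hx.1 i j).lt_of_ne' (haj ▸ ha j))
  · rw [← he i] at hi ⊢
    exact (hround i).resolve_left hi.not_ge

theorem fracCost_nonneg {c x : Fin n → Fin m → ℝ} (hc : ∀ i j, 0 ≤ c i j)
    (hx : IsFracAllocation x) (i : Fin n) : 0 ≤ fracCost c x i :=
  sum_nonneg fun j _ => mul_nonneg (hx.1 i j) (hc i j)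

/-- Market equilibria are fractionally Pareto optimal. -/
theorem IsMarketEquilibrium.isFPO {c x : Fin n → Fin m → ℝ} {r : Fin m → ℝ} {e : Fin n → ℝ}
    (h : IsMarketEquilibrium c x r e) : IsFPO c x := by
  rintro ⟨y, hy, hle, i₀, hlt⟩
  obtain ⟨hx, -, -, mrc, hmrc⟩ := h
  -- All allocations distribute the same total reward. The `mrc`-weighted total cost equals it at
  -- `x` and is at least that at `y`.
  have htotal : ∀ z : Fin n → Fin m → ℝ, IsFracAllocation z →
      ∑ i, ∑ j, z i j * r j = ∑ j, r j := fun z hz => by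
    rw [sum_comm]
    exact sum_congr rfl fun j _ => by rw [← sum_mul, hz.2, one_mul]
  have hxr : ∀ i, mrc i * fracCost c x i = ∑ j, x i j * r j := fun i => by
    rw [fracCost, mul_sum]
    refine sum_congr rfl fun j _ => ?_
    rcases (hx.1 i j).eq_or_lt with h0 | h0
    · simp [← h0]
    · rw [(hmrc i).2.2 j h0]; ring
  have hyr : ∀ i, ∑ j, y i j * r j ≤ mrc i * fracCost c y i := fun i => by
    rw [fracCost, mul_sum]
    refine sum_le_sum fun j _ => ?_
    have := mul_le_mul_of_nonneg_left ((hmrc i).2.1 j) (hy.1 i j)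
    linarith
  have hsum : ∑ i, mrc i * fracCost c y i < ∑ i, mrc i * fracCost c x i :=
    sum_lt_sum (fun i _ => mul_le_mul_of_nonneg_left (hle i) (hmrc i).1.le)
      ⟨i₀, mem_univ _, mul_lt_mul_of_pos_left hlt (hmrc i₀).1⟩
  have := sum_le_sum fun i (_ : i ∈ univ) => hyr i
  rw [htotal y hy] at this
  simp only [hxr, htotal x hx] at hsum
  linarith

/-- After dropping a suitable chore, no agent is worse off than before the rounding. -/
theorem IsEquilibriumRounding.exists_setCost_erase_le {c x : Fin n → Fin m → ℝ} {r : Fin m → ℝ}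
    {e e' : Fin n → ℝ} {a : Fin m → Fin n} (hx : IsMarketEquilibrium c x r e)
    (ha : IsEquilibriumRounding c r e a e') (i : Fin n) (hi : (bundle a i).Nonempty) :
    ∃ j ∈ bundle a i, setCost c i ((bundle a i).erase j) ≤ fracCost c x i := by
  obtain ⟨⟨-, hr, he', mrc, hmrc⟩, hround⟩ := ha
  obtain ⟨hx, -, he, -⟩ := hx
  obtain ⟨hpos, hle, heq⟩ := hmrc i
  obtain ⟨j, hj, hje⟩ : ∃ j ∈ bundle a i, e' i - r j ≤ e i := by
    rcases lt_or_ge (e i) (e' i) with h | h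
    · exact hround i h
    · obtain ⟨j, hj⟩ := hi
      exact ⟨j, hj, by linarith [hr j]⟩
  refine ⟨j, hj, le_of_mul_le_mul_left ?_ hpos⟩
  -- `mrc` belongs to the rounded equilibrium: it gives equality on the bundle of `i` and still
  -- bounds the rewards of the chores in `x i`.
  calc mrc i * setCost c i ((bundle a i).erase j) = ∑ k ∈ (bundle a i).erase j, r k := by
        rw [setCost, mul_sum]
        refine sum_congr rfl fun k hk => (heq k ?_).symm
        have : a k = i := (mem_filter.1 (mem_of_mem_erase hk)).2
        simp [toFrac, this]
    _ = e' i - r j := by rw [sum_erase_eq_sub hj, ← he', sum_toFrac_mul]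
    _ ≤ e i := hje
    _ = ∑ j, x i j * r j := (he i).symm
    _ ≤ mrc i * fracCost c x i := by
        rw [fracCost, mul_sum]
        refine sum_le_sum fun j _ => ?_
        have := mul_le_mul_of_nonneg_left (hle j) (hx.1 i j)
        linarith

/-! ### Minimizers of the normalized `p`-mean: existence and cost bound -/

theorem isFracAllocation_uniform (hn : 0 < n) :
    IsFracAllocation (fun (_ : Fin n) (_ : Fin m) => (1 : ℝ) / n) :=
  ⟨fun _ _ => by positivity, fun _ => by simp [hn.ne']⟩

theorem isCompact_setOf_isFracAllocation :
    IsCompact {x : Fin n → Fin m → ℝ | IsFracAllocation x} := by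
  refine (isCompact_univ_pi fun _ : Fin n => isCompact_univ_pi fun _ : Fin m =>
    isCompact_Icc (a := (0 : ℝ)) (b := 1)).of_isClosed_subset ?_
      fun x hx i _ j _ => ⟨hx.1 i j, hx.le_one i j⟩
  simp only [IsFracAllocation, Set.ofPred_and, Set.ofPred_forall]
  refine (isClosed_iInter fun i => isClosed_iInter fun j => isClosed_le ?_ ?_).inter
    (isClosed_iInter fun j => isClosed_eq ?_ ?_) <;> fun_prop

theorem exists_isNormalizedPMeanMinimizer (hn : 0 < n) (c : Fin n → Fin m → ℝ) {p : ℝ}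
    (hp : 0 < p) : ∃ x : Fin n → Fin m → ℝ, IsNormalizedPMeanMinimizer c p x := by
  have hcont : Continuous fun x : Fin n → Fin m → ℝ => normalizedPMean c p x := by
    unfold normalizedPMean pMean fracCost
    refine Continuous.rpow_const (.div_const (continuous_finsetSum _ fun i _ =>
      Continuous.rpow_const (by fun_prop) fun _ => .inr hp.le) _) fun _ => .inr (by positivity)
  obtain ⟨x, hx, hmin⟩ := isCompact_setOf_isFracAllocation.exists_isMinOn
    ⟨_, isFracAllocation_uniform hn⟩ hcont.continuousOn
  exact ⟨x, hx, fun y hy => hmin hy⟩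

/-- Minimizing the normalized `p`-mean amounts to minimizing the sum of `p`-th powers. -/
theorem IsNormalizedPMeanMinimizer.sum_rpow_le (hn : 0 < n) {c x y : Fin n → Fin m → ℝ}
    (hc : ∀ i j, 0 ≤ c i j) {p : ℝ} (hp : 0 < p) (hx : IsNormalizedPMeanMinimizer c p x)
    (hy : IsFracAllocation y) :
    ∑ i, (fracCost c x i / totalCost c i) ^ p ≤ ∑ i, (fracCost c y i / totalCost c i) ^ p := by
  have hnn : ∀ z : Fin n → Fin m → ℝ, IsFracAllocation z →
      0 ≤ (∑ i, (fracCost c z i / totalCost c i) ^ p) / n := fun z hz =>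
    div_nonneg (sum_nonneg fun i _ => Real.rpow_nonneg (div_nonneg (fracCost_nonneg hc hz i)
      (sum_nonneg fun j _ => hc i j)) _) (Nat.cast_nonneg n)
  have h := hx.2 y hy
  unfold normalizedPMean pMean at h
  rw [Real.rpow_le_rpow_iff (hnn x hx.1) (hnn y hy) (by positivity)] at h
  exact (div_le_div_iff_of_pos_right (by exact_mod_cast hn)).1 h

/-- The equal split gives every agent normalized cost `1 / n`, so the minimal sum of `p`-th powers
is at most `n * (1 / n) ^ p`, and a single term is at most the sum. -/
theorem IsNormalizedPMeanMinimizer.fracCost_le (hn : 0 < n) {c x : Fin n → Fin m → ℝ}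
    (hc : ∀ i j, 0 ≤ c i j) (hpos : ∀ i, 0 < totalCost c i) {p : ℝ} (hp : 0 < p)
    (hx : IsNormalizedPMeanMinimizer c p x) (i : Fin n) :
    fracCost c x i ≤ (n : ℝ) ^ (1 / p) * (totalCost c i / n) := by
  have hn' : (0 : ℝ) < n := by exact_mod_cast hn
  have hu : ∀ i, 0 ≤ fracCost c x i / totalCost c i := fun i =>
    div_nonneg (fracCost_nonneg hc hx.1 i) (hpos i).le
  have hcost : ∀ i, fracCost c (fun _ _ => (1 : ℝ) / n) i / totalCost c i = 1 / n := fun i => by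
    rw [fracCost, ← mul_sum]
    exact mul_div_cancel_right₀ _ (hpos i).ne'
  have hsum := hx.sum_rpow_le hn hc hp (isFracAllocation_uniform hn)
  simp only [hcost, sum_const, card_univ, Fintype.card_fin, nsmul_eq_mul] at hsum
  have hi := (single_le_sum (f := fun i => (fracCost c x i / totalCost c i) ^ p)
    (fun i _ => Real.rpow_nonneg (hu i) _) (mem_univ i)).trans hsum
  have hpow : (n : ℝ) * (1 / n) ^ p = ((n : ℝ) ^ (1 / p) * (1 / n)) ^ p := by
    rw [Real.mul_rpow (by positivity) (by positivity), ← Real.rpow_mul hn'.le,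
      one_div_mul_cancel hp.ne', Real.rpow_one]
  rw [hpow, Real.rpow_le_rpow_iff (hu i) (by positivity) hp, div_le_iff₀ (hpos i)] at hi
  calc _ ≤ _ := hi
    _ = _ := by ring

/-! ### First-order conditions and equilibrium rewards -/

/-- The first-order condition at a minimizer, for moving some of chore `j` from agent `k` to
agent `i`. -/
theorem IsNormalizedPMeanMinimizer.weight_mul_cost_le (hn : 0 < n) {c x : Fin n → Fin m → ℝ}
    (hc : ∀ i j, 0 ≤ c i j) {p : ℝ} (hp : 1 ≤ p)
    (hx : IsNormalizedPMeanMinimizer c p x) {k : Fin n} {j : Fin m} (hkj : 0 < x k j)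
    (i : Fin n) :
    (fracCost c x k / totalCost c k) ^ (p - 1) / totalCost c k * c k j ≤
      (fracCost c x i / totalCost c i) ^ (p - 1) / totalCost c i * c i j := by
  classical
  set d : Fin n → ℝ := fun l => (if l = i then 1 else 0) - if l = k then 1 else 0 with hd
  set z : ℝ → Fin n → Fin m → ℝ := fun t l h => x l h + if h = j then t * d l else 0 with hz
  have hdsum : ∑ l, d l = 0 := by simp [hd]
  have hzfrac : ∀ t ∈ Set.Icc 0 (x k j), IsFracAllocation (z t) := fun t ht => by
    refine ⟨fun l h => ?_, fun h => ?_⟩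
    · by_cases hh : h = j
      · subst hh
        have := hx.1.1 l h
        simp only [hz, hd, if_true]
        split_ifs with h1 h2 h2
        · simpa using this
        · have := ht.1; linarith
        · subst h2; have := ht.2; linarith
        · simpa using this
      · simpa [hz, hh] using hx.1.1 l h
    · by_cases hh : h = j
      · simp [hz, hh, sum_add_distrib, ← mul_sum, hdsum, hx.1.2]
      · simp [hz, hh, hx.1.2]
  have hcost : ∀ t l, fracCost c (z t) l = fracCost c x l + t * (d l * c l j) := fun t l => by
    simp [fracCost, hz, add_mul, sum_add_distrib, mul_assoc]
  have hz0 : z 0 = x := by ext; simp [hz]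
  set g : ℝ → ℝ := fun t => ∑ l, (fracCost c (z t) l / totalCost c l) ^ p with hg
  have hderiv : HasDerivAt g
      (∑ l, d l * c l j / totalCost c l * p * (fracCost c x l / totalCost c l) ^ (p - 1)) 0 := by
    refine HasDerivAt.fun_sum fun l _ => ?_
    have h1 : HasDerivAt (fun t => fracCost c (z t) l / totalCost c l)
        (d l * c l j / totalCost c l) 0 := by
      simp only [hcost]
      simpa using (((hasDerivAt_id (0 : ℝ)).mul_const (d l * c l j)).const_add
        (fracCost c x l)).div_const (totalCost c l)
    -- `1 ≤ p` makes the power differentiable even where an agent's cost is zero.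
    simpa [hz0] using h1.rpow_const (p := p) (.inr hp)
  have hnonneg : 0 ≤
      ∑ l, d l * c l j / totalCost c l * p * (fracCost c x l / totalCost c l) ^ (p - 1) := by
    -- The perturbation is feasible only for `t ≥ 0`, so the sign of the derivative is read off from
    -- right-hand slopes.
    refine ge_of_tendsto ((hasDerivAt_iff_tendsto_slope.1 hderiv).mono_left
      (nhdsWithin_mono 0 (s := Set.Ioi 0) fun t ht => (Set.mem_Ioi.1 ht).ne')) ?_
    filter_upwards [Ioo_mem_nhdsGT hkj] with t ht
    rw [slope_def_field]
    refine div_nonneg (sub_nonneg.2 ?_) (by linarith [ht.1])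
    simpa only [hg, hz0] using hx.sum_rpow_le hn hc (by linarith) (hzfrac t ⟨ht.1.le, ht.2.le⟩)
  have heq : ∑ l, d l * c l j / totalCost c l * p * (fracCost c x l / totalCost c l) ^ (p - 1) =
      p * ((fracCost c x i / totalCost c i) ^ (p - 1) / totalCost c i * c i j -
        (fracCost c x k / totalCost c k) ^ (p - 1) / totalCost c k * c k j) := by
    have : ∀ l, d l * c l j / totalCost c l * p * (fracCost c x l / totalCost c l) ^ (p - 1) =
        d l * (p * ((fracCost c x l / totalCost c l) ^ (p - 1) / totalCost c l * c l j)) :=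
      fun l => by ring
    simp only [this]
    simp [hd, sub_mul, mul_sub]
  rw [heq] at hnonneg
  linarith [nonneg_of_mul_nonneg_right hnonneg (by linarith)]

/-- Every minimizer of the normalized `p`-mean is a market equilibrium for suitable rewards. -/
theorem IsNormalizedPMeanMinimizer.exists_isMarketEquilibrium (hn : 0 < n)
    {c x : Fin n → Fin m → ℝ} (hc : ∀ i j, 0 ≤ c i j) (hpos : ∀ i, 0 < totalCost c i) {p : ℝ}
    (hp : 1 ≤ p) (hx : IsNormalizedPMeanMinimizer c p x) :
    ∃ (r : Fin m → ℝ) (e : Fin n → ℝ), IsMarketEquilibrium c x r e := by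
  have : Nonempty (Fin n) := ⟨⟨0, hn⟩⟩
  set w : Fin n → ℝ := fun i => (fracCost c x i / totalCost c i) ^ (p - 1) / totalCost c i with hw
  have hfoc : ∀ {k j}, 0 < x k j → ∀ i, w k * c k j ≤ w i * c i j := fun h i =>
    hx.weight_mul_cost_le hn hc hp h i
  have hu : ∀ i, 0 ≤ fracCost c x i / totalCost c i := fun i =>
    div_nonneg (fracCost_nonneg hc hx.1 i) (hpos i).le
  have hw0 : ∀ i, 0 ≤ w i := fun i => div_nonneg (Real.rpow_nonneg (hu i) _) (hpos i).le
  by_cases hall : ∀ i, 0 < w i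
  · obtain ⟨r, hr⟩ : ∃ r : Fin m → ℝ, ∀ j, (∃ i, r j = w i * c i j) ∧ ∀ i, r j ≤ w i * c i j := by
      refine Classical.axiomOfChoice (r := fun j r => (∃ i, r = w i * c i j) ∧
        ∀ i, r ≤ w i * c i j) fun j => ?_
      obtain ⟨i, hi⟩ := Finite.exists_min fun i => w i * c i j
      exact ⟨_, ⟨i, rfl⟩, hi⟩
    refine ⟨r, _, hx.1, fun j => ?_, fun i => rfl, w, fun i => ⟨hall i, fun j => (hr j).2 i,
      fun j hij => ?_⟩⟩
    · obtain ⟨i, hi⟩ := (hr j).1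
      exact hi ▸ mul_nonneg (hw0 i) (hc i j)
    · obtain ⟨k, hk⟩ := (hr j).1
      exact le_antisymm ((hr j).2 i) (hk ▸ hfoc hij k)
  -- A zero weight cannot serve as a ratio. But comparing with `i₀` then shows that every performed
  -- chore costs its performer nothing, so zero rewards with all ratios `1` work.
  · push Not at hall
    obtain ⟨i₀, hi₀⟩ := hall
    have hcost : ∀ k j, 0 < x k j → c k j = 0 := by
      intro k j hkj
      by_contra hne
      have hckj : 0 < c k j := (hc k j).lt_of_ne' hne
      have hle := hfoc hkj i₀
      have hwk : w k = 0 := by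
        have : w i₀ * c i₀ j ≤ 0 := mul_nonpos_of_nonpos_of_nonneg hi₀ (hc i₀ j)
        exact le_antisymm (nonpos_of_mul_nonpos_left (hle.trans this) hckj) (hw0 k)
      have huk : 0 < fracCost c x k / totalCost c k := by
        refine div_pos (sum_pos' (fun l _ => mul_nonneg (hx.1.1 k l) (hc k l))
          ⟨j, mem_univ j, mul_pos hkj hckj⟩) (hpos k)
      exact (div_pos (Real.rpow_pos_of_pos huk (p - 1)) (hpos k)).ne' hwk
    refine ⟨0, _, hx.1, fun _ => le_rfl, fun i => rfl, 1, fun i => ⟨one_pos, fun j => ?_,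
      fun j hij => ?_⟩⟩
    · simpa using hc i j
    · simp [hcost i j hij]

end ChoreDivision

theorem mainTheorem3 (n m : ℕ) (hn : 2 ≤ n) (c : Fin n → Fin m → ℝ)
    (hc : ∀ i j, 0 ≤ c i j) (hpos : ∀ i, 0 < ChoreDivision.totalCost c i)
    (p : ℝ) (hp : 1 ≤ p) :
    -- every step of the algorithm can be carried out, whatever was chosen before
    (∃ x : Fin n → Fin m → ℝ, ChoreDivision.IsNormalizedPMeanMinimizer c p x) ∧
    (∀ x : Fin n → Fin m → ℝ, ChoreDivision.IsNormalizedPMeanMinimizer c p x →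
      ∃ (r : Fin m → ℝ) (e : Fin n → ℝ), ChoreDivision.IsMarketEquilibrium c x r e) ∧
    (∀ (x : Fin n → Fin m → ℝ) (r : Fin m → ℝ) (e : Fin n → ℝ),
      ChoreDivision.IsMarketEquilibrium c x r e →
      ∃ (a : Fin m → Fin n) (e' : Fin n → ℝ), ChoreDivision.IsEquilibriumRounding c r e a e') ∧
    -- every output is fractionally Pareto optimal and approximately proportional up to one chore
    (∀ a : Fin m → Fin n, ChoreDivision.IsAlgorithmOutput c p a →
      ChoreDivision.IsFPO c (ChoreDivision.toFrac a) ∧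
      ChoreDivision.IsPROP1 c ((n : ℝ) ^ (1 / p)) a) := by
  have hn0 : 0 < n := by omega
  refine ⟨ChoreDivision.exists_isNormalizedPMeanMinimizer hn0 c (by linarith),
    fun x hx => hx.exists_isMarketEquilibrium hn0 hc hpos hp, fun x r e h => h.exists_rounding, ?_⟩
  rintro a ⟨x, r, e, e', hx, hxe, ha⟩
  refine ⟨ha.1.isFPO, fun i hi => ?_⟩
  obtain ⟨j, hj, hle⟩ := ha.exists_setCost_erase_le hxe i hi
  exact ⟨j, hj, hle.trans (hx.fracCost_le hn0 hc hpos (by linarith) i)⟩
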